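/- Let $D$ be an oriented link diagram (possibly disconnected or empty) with $c_+$ positive and $c_-$ negative crossings and with finite set of regions $\mathrm{Reg}(D)$. At a crossing $c$, turned so that both strands run upwards, let $c_0,c_1,c_2,c_3\in\mathrm{Reg}(D)$ be the upper, left, lower and right region. The amplitude of $D$ is the symmetric matrix $$M_D=\sum_{c}\operatorname{sgn}(c)\sum_{i,j=0}^{3}h_{i\cdot j}\,\chi_{\{(c_i,c_j)\}}\in\mathbb Z[x]^{\mathrm{Reg}(D)\times\mathrm{Reg}(D)},\qquad h_0=1,\quad h_1=x,\quad h_2=2x^2-1,$$ where $\chi$ denotes a characteristic function and $[i\cdot j]_{0\le i,j\le 3}=\begin{bmatrix}2&1&0&1\\1&0&1&0\\0&1&2&1\\1&0&1&0\end{bmatrix}$. For a commutative ring $S$, SR-equivalence is the equivalence relation on pairs $(m,A)$ of a vector $m\in\mathbb Z^2$ and a symmetric $n\times n$ matrix $A$ over $S$ ($n\ge 0$ arbitrary) generated by - $(m,A)\sim(m,M^{\mathsf T}AM)$ for every invertible matrix $M$ of the size of $A$; - $\left(m,\begin{bmatrix}0&1\\1&r\end{bmatrix}\boxplus A\right)\sim(m+(1,1),A)$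 for every $r\in S$; - $(m,[1]\boxplus A)\sim(m+(1,0),A)$, $(m,[-1]\boxplus A)\sim(m+(0,1),A)$ and $(m,[0]\boxplus A)\sim(m+(1,1),A)$, where $\boxplus$ is the block-diagonal sum. Matrices indexed by a finite set are turned into explicit ones by any enumeration of the set. Theorem. Let $R=\mathbb Z[x,\frac1{2x+1}]$, let $S$ be a commutative ring and $R\to S$ a ring homomorphism (for example the identity of $R$, or a quotient of $R$ embedded into $S$). Then the SR-equivalence class over $S$ of the pair $(-(c_+,c_-),M_D)$ does not depend on the enumeration of the regions and is constant on the Reidemeister equivalence class of $D$: if the oriented link diagrams $D$ and $D'$ are related by a finite sequence of Reidemeister moves and isotopies, then their pairs are SR-equivalent over $S$. -/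

import Mathlib

open Polynomial

namespace LinkAmplitude

/-! ## The SR-equivalence relation on symmetric matrices -/

/-- The direct sum of two explicit square matrices, `A` in the upper left corner. -/
def boxPlus {R : Type*} [CommRing R] {k n : ℕ} (A : Matrix (Fin k) (Fin k) R)
    (B : Matrix (Fin n) (Fin n) R) : Matrix (Fin (k + n)) (Fin (k + n)) R :=
  (Matrix.fromBlocks A 0 0 B).submatrix finSumFinEquiv.symm finSumFinEquiv.symm

/-- A pair `(m, A)` of an element `m` of `ℤ²` and a symmetric explicit matrix `A` of any size
`n ≥ 0` over `R`. -/
structure SRPair (R : Type*) [CommRing R] where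
  m : Fin 2 → ℤ
  n : ℕ
  A : Matrix (Fin n) (Fin n) R
  symm : A.IsSymm

/-- The vector `(1 + ε - 2 ε χ) / (1 + ε²)` of `ℤ²`, where `χ = (0, 1)`. -/
def srShift : SignType → Fin 2 → ℤ
  | .pos => ![1, 0]
  | .neg => ![0, 1]
  | .zero => ![1, 1]

/-- The generators of SR-equivalence. -/
inductive SRStep {R : Type*} [CommRing R] : SRPair R → SRPair R → Prop
  /-- `(m, A) ∼ (m, Mᵀ A M)` for `M` invertible -/
  | congruence (m : Fin 2 → ℤ) {n : ℕ} (A M : Matrix (Fin n) (Fin n) R) (hM : IsUnit M)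
      (hA : A.IsSymm) (hA' : (M.transpose * A * M).IsSymm) :
      SRStep ⟨m, n, A, hA⟩ ⟨m, n, M.transpose * A * M, hA'⟩
  /-- `(m, [0 1; 1 r] ⊞ A) ∼ (m + (1, 1), A)` -/
  | hyperbolic (m : Fin 2 → ℤ) (r : R) {n : ℕ} (A : Matrix (Fin n) (Fin n) R)
      (hA : A.IsSymm) (hA' : (boxPlus !![0, 1; 1, r] A).IsSymm) :
      SRStep ⟨m, 2 + n, boxPlus !![0, 1; 1, r] A, hA'⟩ ⟨m + 1, n, A, hA⟩
  /-- `(m, [ε] ⊞ A) ∼ (m + (1 + ε - 2 ε χ) / (1 + ε²), A)` for `ε ∈ {1, -1, 0}` -/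
  | oneByOne (m : Fin 2 → ℤ) (ε : SignType) {n : ℕ} (A : Matrix (Fin n) (Fin n) R)
      (hA : A.IsSymm) (hA' : (boxPlus !![((ε : ℤ) : R)] A).IsSymm) :
      SRStep ⟨m, 1 + n, boxPlus !![((ε : ℤ) : R)] A, hA'⟩ ⟨m + srShift ε, n, A, hA⟩

/-- SR-equivalence: the equivalence relation generated by the steps above. -/
def SREquiv {R : Type*} [CommRing R] : SRPair R → SRPair R → Prop :=
  Relation.EqvGen SRStep

/-! ## Oriented link diagrams

A diagram on the oriented sphere (the plane with a point at infinity) is cut into its crossings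
and finitely many two-valent marked points on its strands; every component without a crossing
carries at least one marked point. Turn each crossing so that both of its strands run upwards.
One strand then runs from the lower left to the upper right (`toRight`), the other one from the
lower right to the upper left (`toLeft`). The crossing is positive if the strand `toRight` is the
upper one, and negative otherwise; thus the sign records the over/under information. -/

inductive Strand
  | toRight
  | toLeft

inductive Side
  | left
  | right

/-- A passage of the link through a crossing or through a marked point. The arc that leaves the
passage `t` is also denoted by `t`. -/
inductive Passage (C P : Type)
  | cross (c : C) (s : Strand)
  | point (p : P)

/-- The four corners at a crossing, where `0, 1, 2, 3` stand for the upper, left, lower and right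
corner, and the two sides of a marked point. -/
inductive Corner (C P : Type)
  | cross (c : C) (i : Fin 4)
  | point (p : P) (s : Side)

/-- The crossing or marked point at which a corner lies. -/
def Corner.node {C P : Type} : Corner C P → C ⊕ P
  | .cross c _ => .inl c
  | .point p _ => .inr p

/-- The corner on a given side of a passage just before its crossing or marked point. -/
def Passage.inCorner {C P : Type} : Passage C P → Side → Corner C P
  | .cross c .toRight, .left => .cross c 1
  | .cross c .toRight, .right => .cross c 2
  | .cross c .toLeft, .left => .cross c 2
  | .cross c .toLeft, .right => .cross c 3
  | .point p, s => .point p s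

/-- The corner on a given side of a passage just after its crossing or marked point. -/
def Passage.outCorner {C P : Type} : Passage C P → Side → Corner C P
  | .cross c .toRight, .left => .cross c 0
  | .cross c .toRight, .right => .cross c 3
  | .cross c .toLeft, .left => .cross c 1
  | .cross c .toLeft, .right => .cross c 0
  | .point p, s => .point p s

/-- The bare data of a diagram: crossings with signs, marked points, regions, the passage that
follows each passage along the link, and the region that contains each corner. -/
structure PreDiagram where
  Crossing : Type
  Point : Type
  Region : Type
  [fintypeCrossing : Fintype Crossing]
  [finitePoint : Finite Point]
  [finiteRegion : Finite Region]
  sign : Crossing → ℤˣ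
  next : Equiv.Perm (Passage Crossing Point)
  region : Corner Crossing Point → Region

attribute [instance] PreDiagram.fintypeCrossing PreDiagram.finitePoint PreDiagram.finiteRegion

namespace PreDiagram

/-- The corners `k` and `k'` are joined by a side of an arc. -/
def Follows (D : PreDiagram) (k k' : Corner D.Crossing D.Point) : Prop :=
  ∃ (t : Passage D.Crossing D.Point) (s : Side), k = t.outCorner s ∧ k' = (D.next t).inCorner s

/-- The closed curves that run along the diagram within the regions: a region with `k` boundary
components contains `k` of them. -/
def BoundaryCycle (D : PreDiagram) : Type := Quot D.Follows

/-- Two regions have corners at a common crossing or marked point. -/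
def Touch (D : PreDiagram) (r r' : D.Region) : Prop :=
  ∃ k k' : Corner D.Crossing D.Point, k.node = k'.node ∧ D.region k = r ∧ D.region k' = r'

end PreDiagram

/-- An oriented link diagram on the sphere, possibly disconnected or empty. -/
structure LinkDiagram extends PreDiagram where
  /-- Each side of an arc lies in one region. -/
  region_follows : ∀ k k', toPreDiagram.Follows k k' → region k = region k'
  /-- The surface glued from the regions is connected. -/
  connected : (SimpleGraph.fromRel toPreDiagram.Touch).Connected
  /-- The surface is a sphere. There are `|Crossing| + |Point|` vertices and
  `2 |Crossing| + |Point|` arcs, and a region with `k` boundary components has Euler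
  characteristic `2 - k`, so the surface has Euler characteristic
  `2 |Region| - |Crossing| - |BoundaryCycle|`. -/
  euler : 2 * (Nat.card Region : ℤ) - (Nat.card Crossing : ℤ)
    - (Nat.card toPreDiagram.BoundaryCycle : ℤ) = 2

/-! ## The amplitude -/

/-- The pairing `i · j` on `{0, 1, 2, 3}` with values in `{0, 1, 2}`. -/
def pairing (i j : Fin 4) : Fin 3 :=
  (!![2, 1, 0, 1;
      1, 0, 1, 0;
      0, 1, 2, 1;
      1, 0, 1, 0] : Matrix (Fin 4) (Fin 4) (Fin 3)) i j

/-- The polynomials `h₀ = 1`, `h₁ = x`, `h₂ = 2 x² - 1`. -/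
noncomputable def hermite : Fin 3 → ℤ[X] :=
  ![1, X, 2 * X ^ 2 - 1]

namespace PreDiagram

open Classical in
/-- The contribution `sgn(c) ∑ h_{i · j} χ_{(cᵢ, cⱼ)}` of a crossing. -/
noncomputable def crossingAmplitude (D : PreDiagram) (c : D.Crossing) :
    Matrix D.Region D.Region ℤ[X] :=
  (D.sign c : ℤ) • ∑ i : Fin 4, ∑ j : Fin 4,
    Matrix.single (D.region (.cross c i)) (D.region (.cross c j)) (hermite (pairing i j))

/-- The amplitude of a diagram. -/
noncomputable def amplitude (D : PreDiagram) : Matrix D.Region D.Region ℤ[X] :=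
  ∑ c : D.Crossing, D.crossingAmplitude c

/-- The numbers of positive and of negative crossings, in this order. -/
noncomputable def crossingNumbers (D : PreDiagram) : Fin 2 → ℤ :=
  ![(Nat.card {c : D.Crossing // D.sign c = 1} : ℤ),
    (Nat.card {c : D.Crossing // D.sign c = -1} : ℤ)]

theorem amplitude_isSymm (D : PreDiagram) : D.amplitude.IsSymm := by
  classical
  have hp : ∀ i j, pairing i j = pairing j i := by decide
  have hc : ∀ c, (D.crossingAmplitude c).transpose = D.crossingAmplitude c := by
    intro c
    unfold crossingAmplitude
    simp only [Matrix.transpose_smul, Matrix.transpose_sum, Matrix.transpose_single]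
    rw [Finset.sum_comm]
    simp only [hp]
  unfold amplitude Matrix.IsSymm
  simp only [Matrix.transpose_sum, hc]

end PreDiagram

/-- The ring `ℤ[x, 1 / (2 x + 1)]`. -/
abbrev BaseRing : Type := Localization.Away (2 * X + 1 : ℤ[X])

/-- The pair `(-(c₊, c₋), M_D)` over a ring `S` that receives `ℤ[x, 1 / (2 x + 1)]`, written as an
explicit matrix by means of an enumeration of the regions. -/
noncomputable def PreDiagram.srPair (D : PreDiagram) {S : Type*} [CommRing S]
    (φ : BaseRing →+* S) {n : ℕ} (e : D.Region ≃ Fin n) : SRPair S where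
  m := -D.crossingNumbers
  n := n
  A := (D.amplitude.map (φ.comp (algebraMap ℤ[X] BaseRing))).submatrix e.symm e.symm
  symm := (D.amplitude_isSymm.map _).submatrix _

/-! ## Reidemeister moves -/

/-- An isomorphism of diagrams. -/
structure PreDiagram.Iso (D D' : PreDiagram) where
  crossing : D.Crossing ≃ D'.Crossing
  point : D.Point ≃ D'.Point
  regionEquiv : D.Region ≃ D'.Region
  sign_eq : ∀ c, D'.sign (crossing c) = D.sign c
  passage : Passage D.Crossing D.Point ≃ Passage D'.Crossing D'.Point
  passage_cross : ∀ c s, passage (.cross c s) = .cross (crossing c) s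
  passage_point : ∀ p, passage (.point p) = .point (point p)
  next_eq : ∀ t, D'.next (passage t) = passage (D.next t)
  region_cross : ∀ c i, D'.region (.cross (crossing c) i) = regionEquiv (D.region (.cross c i))
  region_point : ∀ p s, D'.region (.point (point p) s) = regionEquiv (D.region (.point p s))

/-- A tangle in a disc with `k` numbered oriented strands (and no closed components), whose
endpoints cut the boundary circle into `s` numbered segments. It has `c` crossings, `p` marked
points and `r` regions. -/
structure Tangle (k s c p r : ℕ) where
  sign : Fin c → ℤˣ
  /-- the passages along each strand -/
  path : Fin k → List (Passage (Fin c) (Fin p))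
  region : Corner (Fin c) (Fin p) → Fin r
  /-- the region of the tangle next to each boundary segment -/
  boundary : Fin s → Fin r

/-- The passages of a union. -/
def passageSum (C P C' P' : Type) :
    Passage C P ⊕ Passage C' P' ≃ Passage (C ⊕ C') (P ⊕ P') where
  toFun
    | .inl (.cross c s) => .cross (.inl c) s
    | .inl (.point p) => .point (.inl p)
    | .inr (.cross c s) => .cross (.inr c) s
    | .inr (.point p) => .point (.inr p)
  invFun
    | .cross (.inl c) s => .inl (.cross c s)
    | .point (.inl p) => .inl (.point p)
    | .cross (.inr c) s => .inr (.cross c s)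
    | .point (.inr p) => .inr (.point p)
  left_inv := by rintro ((_ | _) | (_ | _)) <;> rfl
  right_inv := by rintro ((_ | _) | (_ | _)) <;> rfl

namespace PreDiagram

/-- The regions of a union of an exterior and a tangle: regions of the two are glued along the
boundary segments, where `seg` gives the region of the exterior next to each segment. -/
def GlueRegion (E : PreDiagram) {k s c p r : ℕ} (seg : Fin s → E.Region)
    (T : Tangle k s c p r) : Type :=
  Quot fun a b : E.Region ⊕ Fin r =>
    ∃ i : Fin s, a = .inl (seg i) ∧ b = .inr (T.boundary i)

instance (E : PreDiagram) {k s c p r : ℕ} (seg : Fin s → E.Region)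
    (T : Tangle k s c p r) :
    Finite (E.GlueRegion seg T) :=
  inferInstanceAs (Finite (Quot _))

open Classical in
/-- The union of an exterior and a tangle `T`. The data `E` describe the complement of the disc;
there the `j`-th strand of the disc is cut out of the arc that leaves `arc j`. In the union, the
passage `arc j` is followed by the passages of the `j`-th strand of `T` and then by the passage
that follows `arc j` in `E`. -/
noncomputable def glue (E : PreDiagram) {k s c p r : ℕ}
    (arc : Fin k ↪ Passage E.Crossing E.Point) (seg : Fin s → E.Region) (T : Tangle k s c p r) :
    PreDiagram where
  Crossing := E.Crossing ⊕ Fin c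
  Point := E.Point ⊕ Fin p
  Region := E.GlueRegion seg T
  sign := Sum.elim E.sign T.sign
  next := (passageSum E.Crossing E.Point (Fin c) (Fin p)).permCongr
    (Equiv.Perm.sumCongr E.next 1 *
      (List.ofFn fun j => (Sum.inl (arc j) :: (T.path j).map Sum.inr).formPerm).prod)
  region
    | .cross (.inl c) i => Quot.mk _ (.inl (E.region (.cross c i)))
    | .cross (.inr c) i => Quot.mk _ (.inr (T.region (.cross c i)))
    | .point (.inl p) s => Quot.mk _ (.inl (E.region (.point p s)))
    | .point (.inr p) s => Quot.mk _ (.inr (T.region (.point p s)))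

end PreDiagram

namespace Tangle

/-- Regions at the corners of a tangle without marked points, from the table of its rows
`[upper, left, lower, right]`. -/
def cornerTable {c r : ℕ} (f : Fin c → Fin 4 → Fin r) : Corner (Fin c) (Fin 0) → Fin r
  | .cross c i => f c i
  | .point p _ => p.elim0

/-- A strand. The segments and regions `0` and `1` are on its left and on its right. -/
def strand : Tangle 1 2 0 0 2 where
  sign := ![]
  path := ![[]]
  region := cornerTable ![]
  boundary := ![0, 1]

/-- A strand with a marked point. -/
def markedStrand : Tangle 1 2 0 1 2 where
  sign := ![]
  path := ![[.point 0]]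
  region
    | .point _ .left => 0
    | .point _ .right => 1
  boundary := ![0, 1]

/-- A strand with a clockwise kink, which encloses the region `2`. -/
def kinkRight (ε : ℤˣ) : Tangle 1 2 1 0 3 where
  sign := ![ε]
  path := ![[.cross 0 .toRight, .cross 0 .toLeft]]
  region := cornerTable ![![1, 0, 1, 2]]
  boundary := ![0, 1]

/-- A strand with a counterclockwise kink, which encloses the region `2`. -/
def kinkLeft (ε : ℤˣ) : Tangle 1 2 1 0 3 where
  sign := ![ε]
  path := ![[.cross 0 .toLeft, .cross 0 .toRight]]
  region := cornerTable ![![0, 2, 0, 1]]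
  boundary := ![0, 1]

/-- Two vertical strands, strand `0` on the left and strand `1` on the right. The segments
`0, 1, 2, 3` are on the left, at the bottom, on the right and at the top; the bottom and the top
segments both bound the region between the strands. -/
def twoStrands : Tangle 2 4 0 0 3 where
  sign := ![]
  path := ![[], []]
  region := cornerTable ![]
  boundary := ![0, 1, 2, 1]

/-- Strands `0` and `1`, both running upwards, cross at the lower crossing `0` and again at the
upper crossing `1`, with the bigon `4` in between. -/
def bigonParallel (ε : ℤˣ) : Tangle 2 4 2 0 5 where
  sign := ![ε, -ε]
  path := ![[.cross 0 .toRight, .cross 1 .toLeft], [.cross 0 .toLeft, .cross 1 .toRight]]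
  region := cornerTable ![![4, 0, 1, 2], ![3, 0, 4, 2]]
  boundary := ![0, 1, 2, 3]

/-- The same with strand `0` running upwards and strand `1` running downwards. -/
def bigonUpDown (ε : ℤˣ) : Tangle 2 4 2 0 5 where
  sign := ![ε, -ε]
  path := ![[.cross 0 .toLeft, .cross 1 .toRight], [.cross 1 .toLeft, .cross 0 .toRight]]
  region := cornerTable ![![2, 4, 0, 1], ![0, 4, 2, 3]]
  boundary := ![0, 1, 2, 3]

/-- The same with strand `0` running downwards and strand `1` running upwards. -/
def bigonDownUp (ε : ℤˣ) : Tangle 2 4 2 0 5 where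
  sign := ![ε, -ε]
  path := ![[.cross 1 .toRight, .cross 0 .toLeft], [.cross 0 .toRight, .cross 1 .toLeft]]
  region := cornerTable ![![0, 1, 2, 4], ![2, 3, 0, 4]]
  boundary := ![0, 1, 2, 3]

/-! Three strands `0, 1, 2` with lower endpoints in this order from left to right and upper
endpoints in the opposite order. The crossing `0` is that of the strands `0` and `1`, the crossing
`1` that of `0` and `2`, the crossing `2` that of `1` and `2`. The segments `0, …, 5` are: the left
one, the bottom ones from left to right, the right one, the top ones from right to left. The
triangle is the region `6`. -/

/-- All strands run upwards; strand `1` passes to the left of the crossing `1`. -/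
def braidLeft (ε : Fin 3 → ℤˣ) : Tangle 3 6 3 0 7 where
  sign := ε
  path := ![[.cross 0 .toRight, .cross 1 .toRight], [.cross 0 .toLeft, .cross 2 .toRight],
    [.cross 1 .toLeft, .cross 2 .toLeft]]
  region := cornerTable ![![6, 0, 1, 2], ![4, 6, 2, 3], ![5, 0, 6, 4]]
  boundary := ![0, 1, 2, 3, 4, 5]

/-- All strands run upwards; strand `1` passes to the right of the crossing `1`. -/
def braidRight (ε : Fin 3 → ℤˣ) : Tangle 3 6 3 0 7 where
  sign := ε
  path := ![[.cross 1 .toRight, .cross 0 .toRight], [.cross 2 .toRight, .cross 0 .toLeft],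
    [.cross 2 .toLeft, .cross 1 .toLeft]]
  region := cornerTable ![![4, 5, 6, 3], ![5, 0, 1, 6], ![6, 1, 2, 3]]
  boundary := ![0, 1, 2, 3, 4, 5]

/-- Strands `0` and `2` run upwards, strand `1` runs downwards and passes to the left of the
crossing `1`. -/
def cyclicLeft (ε : Fin 3 → ℤˣ) : Tangle 3 6 3 0 7 where
  sign := ε
  path := ![[.cross 0 .toLeft, .cross 1 .toRight], [.cross 2 .toLeft, .cross 0 .toRight],
    [.cross 1 .toLeft, .cross 2 .toRight]]
  region := cornerTable ![![2, 6, 0, 1], ![4, 6, 2, 3], ![0, 6, 4, 5]]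
  boundary := ![0, 1, 2, 3, 4, 5]

/-- Strands `0` and `2` run upwards, strand `1` runs downwards and passes to the right of the
crossing `1`. -/
def cyclicRight (ε : Fin 3 → ℤˣ) : Tangle 3 6 3 0 7 where
  sign := ε
  path := ![[.cross 1 .toRight, .cross 0 .toLeft], [.cross 0 .toRight, .cross 2 .toLeft],
    [.cross 2 .toRight, .cross 1 .toLeft]]
  region := cornerTable ![![3, 4, 5, 6], ![5, 0, 1, 6], ![1, 2, 3, 6]]
  boundary := ![0, 1, 2, 3, 4, 5]

/-- The two tangles of a Reidemeister move, or of the insertion of a marked point. The conditions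
on the signs in the third move say that the three strands lie at different heights, so that one is
above and one is below the other two. -/
inductive Replace : ∀ {k s c p r c' p' r' : ℕ},
    Tangle k s c p r → Tangle k s c' p' r' → Prop
  | mark : Replace strand markedStrand
  | kinkRight (ε : ℤˣ) : Replace strand (kinkRight ε)
  | kinkLeft (ε : ℤˣ) : Replace strand (kinkLeft ε)
  | bigonParallel (ε : ℤˣ) : Replace twoStrands (bigonParallel ε)
  | bigonUpDown (ε : ℤˣ) : Replace twoStrands (bigonUpDown ε)
  | bigonDownUp (ε : ℤˣ) : Replace twoStrands (bigonDownUp ε)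
  | braid (ε : Fin 3 → ℤˣ) (h : ε 1 = ε 0 ∨ ε 1 = ε 2) : Replace (braidLeft ε) (braidRight ε)
  | cyclic (ε : Fin 3 → ℤˣ) (h : ¬(ε 0 = ε 1 ∧ ε 1 = ε 2)) :
      Replace (cyclicLeft ε) (cyclicRight ε)

end Tangle

/-- Two link diagrams are isomorphic, or differ by the replacement of a tangle as in `Replace`. -/
inductive ReidemeisterStep (D D' : LinkDiagram) : Prop
  | iso (f : PreDiagram.Iso D.toPreDiagram D'.toPreDiagram)
  | replace {k s c p r c' p' r' : ℕ} (T : Tangle k s c p r) (T' : Tangle k s c' p' r')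
      (hT : Tangle.Replace T T') (E : PreDiagram)
      (arc : Fin k ↪ Passage E.Crossing E.Point) (seg : Fin s → E.Region)
      (f : PreDiagram.Iso D.toPreDiagram (E.glue arc seg T))
      (f' : PreDiagram.Iso D'.toPreDiagram (E.glue arc seg T'))

/-- Reidemeister equivalence of oriented link diagrams. -/
def ReidemeisterEquiv : LinkDiagram → LinkDiagram → Prop :=
  Relation.EqvGen ReidemeisterStep

end LinkAmplitude

namespace LinkAmplitude

open LinearMap (BilinForm funLeft)

/-! ## SR-equivalence of symmetric bilinear forms -/

section Forms

variable {S : Type*} [CommRing S]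

/-! A symmetric matrix indexed by regions is a symmetric bilinear form on functions on the regions,
and congruence is a linear change of coordinates. A crossing contributes, up to sign, the
polarization of `(u₁ + u₃ + x (u₀ + u₂))² + (x² - 1) (u₀ - u₂)²` in the values at its corners. Hence
the form of a union is the form `F` of the exterior plus the form of the tangle
(`PreDiagram.form_glue`), and a move alters only the second summand. Each move thus reduces to an
identity between small forms, valid for every `F` and for all coincidences among the exterior
regions.

Kink (`SREquiv.of_kink`): two opposite corners coincide, so one square remains, and it contains the
value at the enclosed region with coefficient one. A shear splits off `[±1]`.

Bigon (`SREquiv.of_bigon`): the opposite signs leave a product of `u₃ - u₁` with an expression in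
which the value at the bigon has a unit coefficient. This gives a hyperbolic summand, and on its
complement `u₃ = u₁`, which is the form after the gluing of the top and bottom regions. If these
regions already agree, the bigon splits off `[0]`.

Triangle (`SREquiv.of_triangle`): the square of the value at the triangle has coefficient `±1` or
`±(4 x² - 1)`, and comparison of the mixed terms determines the shear. In the second case the factor
`2 x - 1` cancels, so that only `2 x + 1` has to be inverted.

In each case the shift of `m` makes up for the change of `-(c₊, c₋)`. -/

theorem SREquiv.refl (P : SRPair S) : SREquiv P P := Relation.EqvGen.refl _

theorem SREquiv.of_eq {P Q : SRPair S} (h : P = Q) : SREquiv P Q := h ▸ SREquiv.refl P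

theorem SREquiv.symm {P Q : SRPair S} (h : SREquiv P Q) : SREquiv Q P :=
  Relation.EqvGen.symm _ _ h

theorem SREquiv.trans {P Q T : SRPair S} (h : SREquiv P Q) (h' : SREquiv Q T) : SREquiv P T :=
  Relation.EqvGen.trans _ _ _ h h'

theorem SRPair.ext_of_eq {m m' : Fin 2 → ℤ} {n : ℕ} {A A' : Matrix (Fin n) (Fin n) S}
    {hA : A.IsSymm} {hA' : A'.IsSymm} (hm : m = m') (h : A = A') :
    (⟨m, n, A, hA⟩ : SRPair S) = ⟨m', n, A', hA'⟩ := by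
  subst hm h
  rfl

/-- The Gram matrix of a bilinear form on functions with respect to an enumeration. -/
noncomputable def gram {ι : Type*} (B : BilinForm S (ι → S)) {n : ℕ} (e : ι ≃ Fin n) :
    Matrix (Fin n) (Fin n) S :=
  LinearMap.toMatrix₂' S (B.compl₁₂ (funLeft S S e) (funLeft S S e))

theorem gram_apply {ι : Type*} [DecidableEq ι] (B : BilinForm S (ι → S)) {n : ℕ} (e : ι ≃ Fin n)
    (i j : Fin n) :
    gram B e i j = B (Pi.single (e.symm i) 1) (Pi.single (e.symm j) 1) := by
  have h : ∀ k : Fin n, funLeft S S e (Pi.single k 1) = Pi.single (e.symm k) 1 := by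
    intro k
    ext a
    simp [LinearMap.funLeft_apply, Pi.single_apply, Equiv.eq_symm_apply]
  simp [gram, h]

/-- The pair of a vector and the Gram matrix of a symmetric bilinear form. -/
noncomputable def SRPair.ofForm {ι : Type*} (m : Fin 2 → ℤ) (B : BilinForm S (ι → S))
    (hB : ∀ u v, B u v = B v u) {n : ℕ} (e : ι ≃ Fin n) : SRPair S where
  m := m
  n := n
  A := gram B e
  symm := by
    classical
    ext i j
    simp only [Matrix.transpose_apply, gram_apply]
    exact hB _ _

/-- Forms that correspond to each other under a linear automorphism are SR-equivalent. -/
theorem SREquiv.of_linear {ι κ : Type*} (σ : ι ≃ κ) {m m' : Fin 2 → ℤ} (hm : m = m')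
    {B : BilinForm S (ι → S)} {hB : ∀ u v, B u v = B v u}
    {B' : BilinForm S (κ → S)} {hB' : ∀ u v, B' u v = B' v u}
    (p : (ι → S) →ₗ[S] (κ → S)) (g : (κ → S) →ₗ[S] (ι → S)) (hpg : ∀ w, p (g w) = w)
    (h : ∀ u v, B' (p u) (p v) = B u v) {n n' : ℕ} (e : ι ≃ Fin n) (e' : κ ≃ Fin n') :
    SREquiv (SRPair.ofForm m B hB e) (SRPair.ofForm m' B' hB' e') := by
  subst hm
  obtain rfl : n = n' := by simpa using Fintype.card_congr ((e.symm.trans σ).trans e')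
  set F : (Fin n → S) →ₗ[S] (Fin n → S) := funLeft S S e'.symm ∘ₗ p ∘ₗ funLeft S S e with hF
  set G : (Fin n → S) →ₗ[S] (Fin n → S) := funLeft S S e.symm ∘ₗ g ∘ₗ funLeft S S e' with hG
  have hFG : F ∘ₗ G = LinearMap.id := by
    refine LinearMap.ext fun w => ?_
    have h1 : funLeft S S e (funLeft S S e.symm (g (funLeft S S e' w))) = g (funLeft S S e' w) := by
      ext a
      simp [LinearMap.funLeft_apply]
    simp only [hF, hG, LinearMap.comp_apply, LinearMap.id_apply, h1, hpg]
    ext a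
    simp [LinearMap.funLeft_apply]
  -- Thanks to `σ` the matrices are square of the same size, so a one-sided inverse suffices.
  have hM : IsUnit (LinearMap.toMatrix' F) := by
    have h2 : LinearMap.toMatrix' F * LinearMap.toMatrix' G = 1 := by
      rw [← LinearMap.toMatrix'_comp, hFG, LinearMap.toMatrix'_id]
    exact (Matrix.isUnit_iff_isUnit_det _).2 (Matrix.isUnit_det_of_right_inverse h2)
  have key : (LinearMap.toMatrix' F).transpose * gram B' e' * LinearMap.toMatrix' F
      = gram B e := by
    rw [gram, gram, ← LinearMap.toMatrix₂'_compl₁₂]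
    congr 1
    refine LinearMap.ext₂ fun u v => ?_
    have h3 : ∀ u, funLeft S S e' (F u) = p (funLeft S S e u) := by
      intro u
      ext a
      simp [hF, LinearMap.funLeft_apply]
    simp only [LinearMap.compl₁₂_apply, h3, h]
  refine SREquiv.symm ?_
  have hsymm := (SRPair.ofForm m B hB e).symm
  have step := SRStep.congruence m (gram B' e') (LinearMap.toMatrix' F) hM
    (SRPair.ofForm m B' hB' e').symm (by rw [key]; exact hsymm)
  have := Relation.EqvGen.rel _ _ step
  exact SREquiv.trans this (SREquiv.of_eq (SRPair.ext_of_eq rfl key))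

/-- With `σ` the identity and two different enumerations this gives the independence of the
enumeration. -/
theorem SREquiv.of_equiv {ι κ : Type*} (σ : ι ≃ κ) {m m' : Fin 2 → ℤ} (hm : m = m')
    {B : BilinForm S (ι → S)} {hB : ∀ u v, B u v = B v u}
    {B' : BilinForm S (κ → S)} {hB' : ∀ u v, B' u v = B' v u}
    (h : ∀ u v, B' u v = B (u ∘ σ) (v ∘ σ)) {n n' : ℕ} (e : ι ≃ Fin n) (e' : κ ≃ Fin n') :
    SREquiv (SRPair.ofForm m B hB e) (SRPair.ofForm m' B' hB' e') := by
  refine SREquiv.of_linear σ hm (funLeft S S σ.symm) (funLeft S S σ) ?_ ?_ e e'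
  · intro w
    ext a
    simp [LinearMap.funLeft_apply]
  · intro u v
    rw [h]
    congr 2 <;>
    · ext a
      simp [LinearMap.funLeft_apply]

/-- The orthogonal sum of the form with Gram matrix `P` and a form `B`. -/
noncomputable def sumForm {k : ℕ} {κ : Type*} (P : Matrix (Fin k) (Fin k) S)
    (B : BilinForm S (κ → S)) : BilinForm S (Fin k ⊕ κ → S) :=
  (Matrix.toLinearMap₂' S P).compl₁₂ (funLeft S S Sum.inl) (funLeft S S Sum.inl) +
    B.compl₁₂ (funLeft S S Sum.inr) (funLeft S S Sum.inr)

theorem sumForm_apply {k : ℕ} {κ : Type*} (P : Matrix (Fin k) (Fin k) S)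
    (B : BilinForm S (κ → S)) (u v : Fin k ⊕ κ → S) :
    sumForm P B u v = (∑ i, ∑ j, u (.inl i) * P i j * v (.inl j))
      + B (u ∘ Sum.inr) (v ∘ Sum.inr) := by
  simp only [sumForm, LinearMap.add_apply, LinearMap.compl₁₂_apply, Matrix.toLinearMap₂'_apply]
  congr 1
  refine Finset.sum_congr rfl fun i _ => Finset.sum_congr rfl fun j _ => ?_
  simp only [LinearMap.funLeft_apply, smul_eq_mul]
  ring

theorem sumForm_symm {k : ℕ} {κ : Type*} {P : Matrix (Fin k) (Fin k) S} (hP : P.IsSymm)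
    {B : BilinForm S (κ → S)} (hB : ∀ u v, B u v = B v u) (u v : Fin k ⊕ κ → S) :
    sumForm P B u v = sumForm P B v u := by
  rw [sumForm_apply, sumForm_apply, hB, Finset.sum_comm]
  congr 1
  refine Finset.sum_congr rfl fun i _ => Finset.sum_congr rfl fun j _ => ?_
  rw [hP.apply]
  ring

/-- The enumeration lists the split summand first, as `boxPlus` does, so the generators of
SR-equivalence apply literally. -/
theorem gram_sumForm {k : ℕ} {κ : Type*} (P : Matrix (Fin k) (Fin k) S)
    (B : BilinForm S (κ → S)) {n : ℕ} (e : κ ≃ Fin n) :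
    gram (sumForm P B) ((Equiv.sumCongr (Equiv.refl (Fin k)) e).trans finSumFinEquiv)
      = boxPlus P (gram B e) := by
  classical
  have h1 : ∀ i : Fin k, (Pi.single (Sum.inl i) 1 : Fin k ⊕ κ → S) ∘ Sum.inr = 0 := by
    intro i; ext a; simp
  have h2 : ∀ i : κ, (Pi.single (Sum.inr i) 1 : Fin k ⊕ κ → S) ∘ Sum.inr = Pi.single i 1 := by
    intro i; ext a; simp [Pi.single_apply]
  ext i j
  obtain ⟨i, rfl⟩ := finSumFinEquiv.surjective i
  obtain ⟨j, rfl⟩ := finSumFinEquiv.surjective j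
  rcases i with i | i <;> rcases j with j | j <;>
    simp [gram_apply, boxPlus, sumForm_apply, h1, h2, Pi.single_apply]

/-- A form that splits off a summand of rank one with Gram matrix `[ε]`. -/
theorem SREquiv.split_one {ι κ : Type*} (σ : ι ≃ Fin 1 ⊕ κ) {m m' : Fin 2 → ℤ} (ε : SignType)
    (hm : m' = m + srShift ε) {B : BilinForm S (ι → S)} {hB : ∀ u v, B u v = B v u}
    {B' : BilinForm S (κ → S)} {hB' : ∀ u v, B' u v = B' v u}
    (p : (ι → S) →ₗ[S] (Fin 1 ⊕ κ → S)) (g : (Fin 1 ⊕ κ → S) →ₗ[S] (ι → S))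
    (hpg : ∀ w, p (g w) = w)
    (h : ∀ u v, B u v = p u (.inl 0) * ((ε : ℤ) : S) * p v (.inl 0)
      + B' (p u ∘ Sum.inr) (p v ∘ Sum.inr))
    {n n' : ℕ} (e : ι ≃ Fin n) (e' : κ ≃ Fin n') :
    SREquiv (SRPair.ofForm m B hB e) (SRPair.ofForm m' B' hB' e') := by
  have hP : (!![((ε : ℤ) : S)]).IsSymm := by
    ext i j; fin_cases i; fin_cases j; rfl
  refine (SREquiv.of_linear (B' := sumForm !![((ε : ℤ) : S)] B') (hB' := sumForm_symm hP hB') σ rfl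
    p g hpg ?_ e ((Equiv.sumCongr (Equiv.refl (Fin 1)) e').trans finSumFinEquiv)).trans ?_
  · intro u v
    rw [h, sumForm_apply]
    simp
  · subst hm
    have h2 := gram_sumForm !![((ε : ℤ) : S)] B' e'
    have hs := (SRPair.ofForm m _ (sumForm_symm hP hB')
      ((Equiv.sumCongr (Equiv.refl (Fin 1)) e').trans finSumFinEquiv)).symm
    have step := SRStep.oneByOne m ε (gram B' e') (SRPair.ofForm m B' hB' e').symm
      (by rw [← h2]; exact hs)
    have := Relation.EqvGen.rel _ _ step
    exact (SREquiv.of_eq (SRPair.ext_of_eq rfl h2)).trans this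

/-- A form that splits off a summand of rank two with Gram matrix `[0 1; 1 r]`. -/
theorem SREquiv.split_hyperbolic {ι κ : Type*} (σ : ι ≃ Fin 2 ⊕ κ) {m m' : Fin 2 → ℤ} (r : S)
    (hm : m' = m + 1) {B : BilinForm S (ι → S)} {hB : ∀ u v, B u v = B v u}
    {B' : BilinForm S (κ → S)} {hB' : ∀ u v, B' u v = B' v u}
    (p : (ι → S) →ₗ[S] (Fin 2 ⊕ κ → S)) (g : (Fin 2 ⊕ κ → S) →ₗ[S] (ι → S))
    (hpg : ∀ w, p (g w) = w)
    (h : ∀ u v, B u v = p u (.inl 0) * p v (.inl 1) + p u (.inl 1) * p v (.inl 0)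
      + r * p u (.inl 1) * p v (.inl 1) + B' (p u ∘ Sum.inr) (p v ∘ Sum.inr))
    {n n' : ℕ} (e : ι ≃ Fin n) (e' : κ ≃ Fin n') :
    SREquiv (SRPair.ofForm m B hB e) (SRPair.ofForm m' B' hB' e') := by
  have hP : (!![0, 1; 1, r]).IsSymm := by
    ext i j; fin_cases i <;> fin_cases j <;> rfl
  refine (SREquiv.of_linear (B' := sumForm !![0, 1; 1, r] B') (hB' := sumForm_symm hP hB') σ rfl
    p g hpg ?_ e ((Equiv.sumCongr (Equiv.refl (Fin 2)) e').trans finSumFinEquiv)).trans ?_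
  · intro u v
    rw [h, sumForm_apply]
    simp [Fin.sum_univ_two]
    ring
  · subst hm
    have h2 := gram_sumForm !![0, 1; 1, r] B' e'
    have hs := (SRPair.ofForm m _ (sumForm_symm hP hB')
      ((Equiv.sumCongr (Equiv.refl (Fin 2)) e').trans finSumFinEquiv)).symm
    have step := SRStep.hyperbolic m r (gram B' e') (SRPair.ofForm m B' hB' e').symm
      (by rw [← h2]; exact hs)
    have := Relation.EqvGen.rel _ _ step
    exact (SREquiv.of_eq (SRPair.ext_of_eq rfl h2)).trans this

end Forms

/-! ## The form of a diagram -/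

section RegionForm

variable {S : Type*} [CommRing S]

/-- The symmetric bilinear form of a positive crossing on functions on its four corners. -/
def crossingForm (x : S) : BilinForm S (Fin 4 → S) :=
  LinearMap.mk₂ S (fun u v => (u 1 + u 3 + x * (u 0 + u 2)) * (v 1 + v 3 + x * (v 0 + v 2))
      + (x ^ 2 - 1) * (u 0 - u 2) * (v 0 - v 2))
    (by intros; simp only [Pi.add_apply]; ring)
    (by intros; simp only [Pi.smul_apply, smul_eq_mul]; ring)
    (by intros; simp only [Pi.add_apply]; ring)
    (by intros; simp only [Pi.smul_apply, smul_eq_mul]; ring)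

/-- This shape of `∑ h_{i · j} uᵢ vⱼ` (the agreement is checked in `PreDiagram.srPair_eq`) shows
that the second term disappears when the upper and lower corners lie in one region. -/
theorem crossingForm_apply (x : S) (u v : Fin 4 → S) :
    crossingForm x u v = (u 1 + u 3 + x * (u 0 + u 2)) * (v 1 + v 3 + x * (v 0 + v 2))
      + (x ^ 2 - 1) * (u 0 - u 2) * (v 0 - v 2) := rfl

/-- The signed sum of the forms of crossings whose corners lie in the given regions. -/
def regionForm {C ι : Type*} [Fintype C] (x : S) (sign : C → ℤˣ) (region : C → Fin 4 → ι) :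
    BilinForm S (ι → S) :=
  ∑ c, (sign c : ℤ) • (crossingForm x).compl₁₂ (funLeft S S (region c)) (funLeft S S (region c))

theorem regionForm_apply {C ι : Type*} [Fintype C] (x : S) (sign : C → ℤˣ)
    (region : C → Fin 4 → ι) (u v : ι → S) :
    regionForm x sign region u v
      = ∑ c, ((sign c : ℤ) : S) * crossingForm x (u ∘ region c) (v ∘ region c) := by
  simp only [regionForm, LinearMap.sum_apply, LinearMap.smul_apply, LinearMap.compl₁₂_apply,
    zsmul_eq_mul]
  rfl

theorem regionForm_symm {C ι : Type*} [Fintype C] (x : S) (sign : C → ℤˣ)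
    (region : C → Fin 4 → ι) (u v : ι → S) :
    regionForm x sign region u v = regionForm x sign region v u := by
  simp only [regionForm_apply, crossingForm_apply]
  refine Finset.sum_congr rfl fun c _ => ?_
  ring

/-- The contribution of a crossing of a given sign to `(c₊, c₋)`. -/
def signVector (ε : ℤˣ) : Fin 2 → ℤ := if ε = 1 then ![1, 0] else ![0, 1]

/-- A sign as an element of `SignType`. -/
def unitSign (ε : ℤˣ) : SignType := if ε = 1 then 1 else -1

theorem srShift_unitSign (ε : ℤˣ) : srShift (unitSign ε) = signVector ε := by
  rcases Int.units_eq_one_or ε with rfl | rfl <;> rfl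

theorem coe_unitSign (ε : ℤˣ) : ((unitSign ε : SignType) : ℤ) = (ε : ℤ) := by
  rcases Int.units_eq_one_or ε with rfl | rfl <;> rfl

theorem signVector_add_neg (ε : ℤˣ) : signVector ε + signVector (-ε) = 1 := by
  rcases Int.units_eq_one_or ε with rfl | rfl <;> decide

theorem PreDiagram.crossingNumbers_eq (D : PreDiagram) :
    D.crossingNumbers = ∑ c, signVector (D.sign c) := by
  classical
  have h : ∀ c, signVector (D.sign c)
      = ![if D.sign c = 1 then 1 else 0, if D.sign c = -1 then 1 else 0] := by
    intro c
    rcases Int.units_eq_one_or (D.sign c) with h | h <;> rw [h] <;> decide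
  ext i
  rw [Finset.sum_apply]
  fin_cases i <;> simp [PreDiagram.crossingNumbers, h, Nat.card_eq_fintype_card, Fintype.card_subtype]

/-- The image of `x` in `S`. -/
noncomputable def variableImage (φ : BaseRing →+* S) : S :=
  φ.comp (algebraMap ℤ[X] BaseRing) X

theorem isUnit_two_mul_variableImage_add_one (φ : BaseRing →+* S) :
    IsUnit (2 * variableImage φ + 1) := by
  have h := (IsLocalization.Away.algebraMap_isUnit (S := BaseRing) (2 * X + 1 : ℤ[X])).map φ
  have h2 : φ (algebraMap ℤ[X] BaseRing (2 * X + 1)) = 2 * variableImage φ + 1 := by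
    rw [map_add, map_mul, map_add, map_mul, map_one, map_one, map_ofNat, map_ofNat]
    rfl
  rwa [h2] at h

/-- The bilinear form of a diagram over `S`. -/
noncomputable def PreDiagram.form (D : PreDiagram) (φ : BaseRing →+* S) :
    BilinForm S (D.Region → S) :=
  regionForm (variableImage φ) D.sign fun c i => D.region (.cross c i)

theorem PreDiagram.form_symm (D : PreDiagram) (φ : BaseRing →+* S) (u v : D.Region → S) :
    D.form φ u v = D.form φ v u := regionForm_symm _ _ _ _ _

theorem _root_.Matrix.single_apply_eq_mul {ι A : Type*} [DecidableEq ι] [CommRing A] (r s a b : ι)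
    (h : A) :
    Matrix.single a b h r s = h * ((if a = r then 1 else 0) * (if b = s then 1 else 0)) := by
  rw [Matrix.single_apply]
  by_cases h1 : a = r <;> by_cases h2 : b = s <;> simp [h1, h2]

-- The entries of `Matrix.single` are products of two indicators, which are the values of two
-- standard basis functions at two corners. Corners in the same region add up on both sides, so
-- pulling `crossingForm` back along the corners gives the amplitude.
open Classical in
theorem PreDiagram.srPair_eq (D : PreDiagram) (φ : BaseRing →+* S) {n : ℕ}
    (e : D.Region ≃ Fin n) :
    D.srPair φ e = SRPair.ofForm (-D.crossingNumbers) (D.form φ) (D.form_symm φ) e := by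
  refine SRPair.ext_of_eq rfl ?_
  ext i j
  rw [gram_apply, PreDiagram.form, regionForm_apply]
  simp only [Matrix.submatrix_apply, Matrix.map_apply, PreDiagram.amplitude, Matrix.sum_apply,
    map_sum]
  refine Finset.sum_congr rfl fun c _ => ?_
  simp only [PreDiagram.crossingAmplitude, Matrix.smul_apply, zsmul_eq_mul]
  generalize e.symm i = r
  generalize e.symm j = s
  generalize hψ : φ.comp (algebraMap ℤ[X] BaseRing) = ψ
  have hx : variableImage φ = ψ X := by rw [variableImage, hψ]
  rw [hx]
  simp only [Matrix.sum_apply, Matrix.add_apply, map_add, Matrix.single_apply_eq_mul r s, map_mul,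
    crossingForm_apply, Function.comp_apply, Fin.sum_univ_four]
  have hi : ∀ a b : D.Region, ψ (if b = a then 1 else 0) = (Pi.single a 1 : D.Region → S) b := by
    intro a b
    rw [Pi.single_apply, apply_ite ψ, map_one, map_zero]
  have h2 : ψ 2 = 2 := map_ofNat ψ 2
  simp only [hi]
  simp [pairing, hermite, h2]
  ring

end RegionForm

/-! ## The form of the union of an exterior and a tangle -/

section Glue

variable {S : Type*} [CommRing S]

/-- The bilinear form of a tangle. -/
def Tangle.form {k s c p r : ℕ} (T : Tangle k s c p r) (x : S) : BilinForm S (Fin r → S) :=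
  regionForm x T.sign fun c i => T.region (.cross c i)

/-- The numbers of positive and negative crossings of a tangle. -/
def Tangle.crossingNumbers {k s c p r : ℕ} (T : Tangle k s c p r) : Fin 2 → ℤ :=
  ∑ c, signVector (T.sign c)

/-- The sum of a form on the regions of an exterior and the form of a tangle, pulled back to a
model `X` of the set of regions of the union. -/
def glueForm {R X : Type*} {k s c p r : ℕ} (F : BilinForm S (R → S)) (T : Tangle k s c p r)
    (x : S) (a : R → X) (t : Fin r → X) : BilinForm S (X → S) :=
  F.compl₁₂ (funLeft S S a) (funLeft S S a)
    + (T.form x).compl₁₂ (funLeft S S t) (funLeft S S t)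

theorem glueForm_apply {R X : Type*} {k s c p r : ℕ} (F : BilinForm S (R → S))
    (T : Tangle k s c p r) (x : S) (a : R → X) (t : Fin r → X) (u v : X → S) :
    glueForm F T x a t u v = F (u ∘ a) (v ∘ a) + T.form x (u ∘ t) (v ∘ t) := rfl

theorem glueForm_symm {R X : Type*} {k s c p r : ℕ} {F : BilinForm S (R → S)}
    (hF : ∀ u v, F u v = F v u) (T : Tangle k s c p r) (x : S) (a : R → X) (t : Fin r → X)
    (u v : X → S) : glueForm F T x a t u v = glueForm F T x a t v u := by
  rw [glueForm_apply, glueForm_apply, hF, Tangle.form, regionForm_symm]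

/-- A model for the set of regions of the union of an exterior and a tangle. -/
structure RegionModel (E : PreDiagram) {k s c p r : ℕ} (seg : Fin s → E.Region)
    (T : Tangle k s c p r) (X : Type) where
  ofExterior : E.Region → X
  ofTangle : Fin r → X
  toGlue : X → E.GlueRegion seg T
  compat : ∀ i, ofExterior (seg i) = ofTangle (T.boundary i)
  toGlue_ofExterior : ∀ a, toGlue (ofExterior a) = Quot.mk _ (.inl a)
  toGlue_ofTangle : ∀ a, toGlue (ofTangle a) = Quot.mk _ (.inr a)
  cover : ∀ y, (∃ a, ofExterior a = y) ∨ ∃ a, ofTangle a = y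

/-- The bijection from the regions of the union to a model. -/
def RegionModel.equiv {E : PreDiagram} {k s c p r : ℕ} {seg : Fin s → E.Region}
    {T : Tangle k s c p r} {X : Type} (M : RegionModel E seg T X) : E.GlueRegion seg T ≃ X where
  toFun := Quot.lift (Sum.elim M.ofExterior M.ofTangle) (by
    rintro _ _ ⟨i, rfl, rfl⟩
    exact M.compat i)
  invFun := M.toGlue
  left_inv := by
    rintro ⟨a | a⟩
    · exact M.toGlue_ofExterior a
    · exact M.toGlue_ofTangle a
  right_inv := by
    intro y
    rcases M.cover y with ⟨a, rfl⟩ | ⟨a, rfl⟩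
    · rw [M.toGlue_ofExterior]; rfl
    · rw [M.toGlue_ofTangle]; rfl

theorem PreDiagram.Iso.crossingNumbers_eq {D D' : PreDiagram} (f : PreDiagram.Iso D D') :
    D.crossingNumbers = D'.crossingNumbers := by
  rw [PreDiagram.crossingNumbers_eq, PreDiagram.crossingNumbers_eq]
  exact Fintype.sum_equiv f.crossing _ _ fun c => by rw [f.sign_eq]

theorem PreDiagram.Iso.form_eq {D D' : PreDiagram} (f : PreDiagram.Iso D D')
    (φ : BaseRing →+* S) (u v : D'.Region → S) :
    D.form φ (u ∘ f.regionEquiv) (v ∘ f.regionEquiv) = D'.form φ u v := by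
  rw [PreDiagram.form, PreDiagram.form, regionForm_apply, regionForm_apply]
  refine Fintype.sum_equiv f.crossing _ _ fun c => ?_
  have h : ∀ w : D'.Region → S, (w ∘ fun i => D'.region (.cross (f.crossing c) i))
      = (w ∘ f.regionEquiv) ∘ fun i => D.region (.cross c i) := by
    intro w
    ext i
    simp [f.region_cross]
  rw [f.sign_eq, h, h]

theorem SREquiv.of_iso {D D' : PreDiagram} (f : PreDiagram.Iso D D') (φ : BaseRing →+* S)
    {n n' : ℕ} (e : D.Region ≃ Fin n) (e' : D'.Region ≃ Fin n') :
    SREquiv (D.srPair φ e) (D'.srPair φ e') := by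
  rw [PreDiagram.srPair_eq, PreDiagram.srPair_eq]
  refine SREquiv.of_equiv f.regionEquiv (by rw [f.crossingNumbers_eq]) ?_ e e'
  intro u v
  exact (f.form_eq φ u v).symm

theorem PreDiagram.crossingNumbers_glue (E : PreDiagram) {k s c p r : ℕ}
    (arc : Fin k ↪ Passage E.Crossing E.Point) (seg : Fin s → E.Region)
    (T : Tangle k s c p r) :
    (E.glue arc seg T).crossingNumbers = E.crossingNumbers + T.crossingNumbers := by
  rw [PreDiagram.crossingNumbers_eq, PreDiagram.crossingNumbers_eq]
  exact Fintype.sum_sum_type _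

/-- The crossings of the union are those of the two pieces, and the region of a corner is the class
of its region in its own piece; the succession of passages plays no role. -/
theorem PreDiagram.form_glue (E : PreDiagram) {k s c p r : ℕ}
    (arc : Fin k ↪ Passage E.Crossing E.Point) (seg : Fin s → E.Region)
    (T : Tangle k s c p r) (φ : BaseRing →+* S) (u v : E.GlueRegion seg T → S) :
    (E.glue arc seg T).form φ u v
      = E.form φ (fun a => u (Quot.mk _ (.inl a))) (fun a => v (Quot.mk _ (.inl a)))
        + T.form (variableImage φ) (fun a => u (Quot.mk _ (.inr a)))
          (fun a => v (Quot.mk _ (.inr a))) := by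
  refine (regionForm_apply _ _ _ _ _).trans ((Fintype.sum_sum_type _).trans ?_)
  refine congrArg₂ _ ?_ ?_
  · rw [PreDiagram.form, regionForm_apply]
    rfl
  · rw [Tangle.form, regionForm_apply]
    rfl

/-- The pair of a union in terms of a model for its set of regions. -/
theorem SREquiv.of_regionModel {D E : PreDiagram} {k s c p r : ℕ}
    {arc : Fin k ↪ Passage E.Crossing E.Point} {seg : Fin s → E.Region} {T : Tangle k s c p r}
    (f : PreDiagram.Iso D (E.glue arc seg T)) {X : Type} (M : RegionModel E seg T X)
    (φ : BaseRing →+* S) {n n' : ℕ} (e : D.Region ≃ Fin n) (e' : X ≃ Fin n') :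
    SREquiv (D.srPair φ e) (SRPair.ofForm (-(E.crossingNumbers + T.crossingNumbers))
      (glueForm (E.form φ) T (variableImage φ) M.ofExterior M.ofTangle)
      (glueForm_symm (E.form_symm φ) _ _ _ _) e') := by
  refine (SREquiv.of_iso f φ e (M.equiv.trans e')).trans ?_
  refine (SREquiv.of_eq (PreDiagram.srPair_eq _ _ _)).trans ?_
  refine SREquiv.of_equiv M.equiv (by rw [PreDiagram.crossingNumbers_glue]) ?_ _ _
  intro u v
  exact (PreDiagram.form_glue E arc seg T φ (u ∘ M.equiv) (v ∘ M.equiv)).symm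

end Glue

/-! ## The forms of the tangles -/

section TangleForms

variable {S : Type*} [CommRing S]

open Tangle

theorem strand_form (x : S) (u v : Fin 2 → S) : strand.form x u v = 0 := by
  simp [Tangle.form, regionForm_apply]

theorem markedStrand_form (x : S) (u v : Fin 2 → S) : markedStrand.form x u v = 0 := by
  simp [Tangle.form, regionForm_apply]

theorem twoStrands_form (x : S) (u v : Fin 3 → S) : twoStrands.form x u v = 0 := by
  simp [Tangle.form, regionForm_apply]

/-- The upper and the lower corner both lie in region `1`, so only the first square of
`crossingForm` survives. The factor `1` is kept to fit the shape `a * u 0 + b * u 1` in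
`SREquiv.of_kink`. -/
theorem kinkRight_form (ε : ℤˣ) (x : S) (u v : Fin 3 → S) :
    (kinkRight ε).form x u v
      = ((ε : ℤ) : S) * (u 2 + (1 * u 0 + 2 * x * u 1)) * (v 2 + (1 * v 0 + 2 * x * v 1)) := by
  simp [Tangle.form, regionForm_apply, crossingForm_apply, kinkRight, cornerTable]
  ring

theorem kinkLeft_form (ε : ℤˣ) (x : S) (u v : Fin 3 → S) :
    (kinkLeft ε).form x u v
      = ((ε : ℤ) : S) * (u 2 + (2 * x * u 0 + 1 * u 1)) * (v 2 + (2 * x * v 0 + 1 * v 1)) := by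
  simp [Tangle.form, regionForm_apply, crossingForm_apply, kinkLeft, cornerTable]
  ring

/-- The common shape of the forms of the bigons. -/
def bigonForm (ε : ℤˣ) (x q : S) (u v : Fin 5 → S) : S :=
  -((ε : ℤ) : S) * ((u 3 - u 1) * (v 4 + x * (v 0 + v 2) + q * v 1)
    + (u 4 + x * (u 0 + u 2) + q * u 1) * (v 3 - v 1) + q * (u 3 - u 1) * (v 3 - v 1))

/-- The crossings share the side regions and the bigon and have opposite signs, so the terms in
these regions alone cancel; the rest vanishes when `u 3 = u 1`. The parameter `q` is the diagonal
entry at the outer corners `1` and `3` of the bigon: `h₂` here, where they are lower and upper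
corners, and `h₀ = 1` for antiparallel strands, where they are left or right corners. -/
theorem bigonParallel_form (ε : ℤˣ) (x : S) (u v : Fin 5 → S) :
    (bigonParallel ε).form x u v = bigonForm ε x (2 * x ^ 2 - 1) u v := by
  simp [Tangle.form, regionForm_apply, crossingForm_apply, bigonParallel, cornerTable, bigonForm]
  ring

theorem bigonUpDown_form (ε : ℤˣ) (x : S) (u v : Fin 5 → S) :
    (bigonUpDown ε).form x u v = bigonForm ε x 1 u v := by
  simp [Tangle.form, regionForm_apply, crossingForm_apply, bigonUpDown, cornerTable, bigonForm]
  ring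

theorem bigonDownUp_form (ε : ℤˣ) (x : S) (u v : Fin 5 → S) :
    (bigonDownUp ε).form x u v = bigonForm ε x 1 u v := by
  simp [Tangle.form, regionForm_apply, crossingForm_apply, bigonDownUp, cornerTable, bigonForm]
  ring

/-- The addition to the value at the triangle of a linear combination of the other values. -/
def triangleShear (c : Fin 6 → S) (u : Fin 7 → S) : Fin 7 → S :=
  ![u 0, u 1, u 2, u 3, u 4, u 5, u 6 + (c 0 * u 0 + c 1 * u 1 + c 2 * u 2 + c 3 * u 3
    + c 4 * u 4 + c 5 * u 5)]

/-- On both sides the square of the value at the triangle has coefficient `(ε 0 + ε 2) (2 x² - 1) +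
ε 1`. Under `h` this is `ε 1` if `ε 0 ≠ ε 2`, and `ε 2 (4 x² - 1)` if all signs agree. The shear is
found by matching the terms linear in that value; the remaining terms then agree as well. -/
theorem exists_triangleShear_braid (ε : Fin 3 → ℤˣ) (h : ε 1 = ε 0 ∨ ε 1 = ε 2) {x : S}
    (hx : IsUnit (2 * x + 1)) :
    ∃ c : Fin 6 → S, ∀ u v, (braidRight ε).form x u v
      = (braidLeft ε).form x (triangleShear c u) (triangleShear c v) := by
  by_cases h' : ε 0 = ε 2
  · obtain ⟨y, hy⟩ := hx.exists_right_inv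
    -- The linear terms differ by `ε 2 (2 x - 1)` times the alternating sum of the outer values;
    -- division by `ε 2 (2 x - 1) (2 x + 1)` leaves `y = 1 / (2 x + 1)`.
    refine ⟨![-y, y, -y, y, -y, y], fun u v => ?_⟩
    have h1 : ε 1 = ε 2 := by rcases h with h | h <;> simp [h, h']
    simp [Tangle.form, regionForm_apply, crossingForm_apply, braidLeft, braidRight, cornerTable,
      triangleShear, Fin.sum_univ_three, h', h1]
    linear_combination ((ε 2 : ℤ) : S)
      * ((2 * x - 1) * (u 6 * (v 0 - v 1 + v 2 - v 3 + v 4 - v 5)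
          + (u 0 - u 1 + u 2 - u 3 + u 4 - u 5) * v 6)
        - (2 * x - 1) * y * (u 0 - u 1 + u 2 - u 3 + u 4 - u 5)
          * (v 0 - v 1 + v 2 - v 3 + v 4 - v 5)
        + (u 0 + u 2 + u 4) * (v 0 + v 2 + v 4) - (u 1 + u 3 + u 5) * (v 1 + v 3 + v 5)) * hy
  · obtain ⟨e0, he0⟩ : ∃ e : S, ((ε 0 : ℤ) : S) = e := ⟨_, rfl⟩
    obtain ⟨e1, he1⟩ : ∃ e : S, ((ε 1 : ℤ) : S) = e := ⟨_, rfl⟩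
    obtain ⟨e2, he2⟩ : ∃ e : S, ((ε 2 : ℤ) : S) = e := ⟨_, rfl⟩
    -- The two vectors are the linear coefficients at the triangle on the right and on the left; the
    -- leading coefficient `e1` is its own inverse.
    refine ⟨fun i => e1 * (![e1, (e1 + e2) * x, e2, (e0 + e2) * x, e0, (e0 + e1) * x] i
      - ![(e0 + e2) * x, e0, (e0 + e1) * x, e1, (e1 + e2) * x, e2] i), fun u v => ?_⟩
    simp [Tangle.form, regionForm_apply, crossingForm_apply, braidLeft, braidRight, cornerTable,
      triangleShear, Fin.sum_univ_three, he0, he1, he2]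
    -- The sign patterns excluded by `h` or `h'` are contradictory; the others leave polynomial
    -- identities in `x`.
    rcases Int.units_eq_one_or (ε 0) with h0 | h0 <;>
    rcases Int.units_eq_one_or (ε 1) with h1 | h1 <;>
    rcases Int.units_eq_one_or (ε 2) with h2 | h2 <;>
    simp [h0, h1, h2] at h h' he0 he1 he2 <;>
    · subst he0 he1 he2
      ring

/-- The triangle is a left or right corner of each crossing, so its leading coefficient is `ε 0 + ε
1 + ε 2`. As the signs are not all equal, this is `±1` and its own inverse, and the shear is
obtained as in the braid case. -/
theorem exists_triangleShear_cyclic (ε : Fin 3 → ℤˣ) (h : ¬(ε 0 = ε 1 ∧ ε 1 = ε 2)) (x : S) :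
    ∃ c : Fin 6 → S, ∀ u v, (cyclicRight ε).form x u v
      = (cyclicLeft ε).form x (triangleShear c u) (triangleShear c v) := by
  obtain ⟨e0, he0⟩ : ∃ e : S, ((ε 0 : ℤ) : S) = e := ⟨_, rfl⟩
  obtain ⟨e1, he1⟩ : ∃ e : S, ((ε 1 : ℤ) : S) = e := ⟨_, rfl⟩
  obtain ⟨e2, he2⟩ : ∃ e : S, ((ε 2 : ℤ) : S) = e := ⟨_, rfl⟩
  refine ⟨fun i => (e0 + e1 + e2) *
    (![e1, (e1 + e2) * x, e2, (e0 + e2) * x, e0, (e0 + e1) * x] i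
      - ![(e0 + e2) * x, e0, (e0 + e1) * x, e1, (e1 + e2) * x, e2] i), fun u v => ?_⟩
  simp [Tangle.form, regionForm_apply, crossingForm_apply, cyclicLeft, cyclicRight, cornerTable,
    triangleShear, Fin.sum_univ_three, he0, he1, he2]
  rcases Int.units_eq_one_or (ε 0) with h0 | h0 <;>
  rcases Int.units_eq_one_or (ε 1) with h1 | h1 <;>
  rcases Int.units_eq_one_or (ε 2) with h2 | h2 <;>
  simp [h0, h1, h2] at h he0 he1 he2 <;>
  · subst he0 he1 he2
    ring

end TangleForms

/-! ## Models for the regions of unions -/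

section Models

open Tangle

/-- The model if all regions of the tangle meet the boundary in exactly one segment. -/
def RegionModel.ofStrand (E : PreDiagram) {k s c p : ℕ} (seg : Fin s → E.Region)
    (T : Tangle k s c p s) (h : ∀ i, T.boundary i = i) : RegionModel E seg T E.Region where
  ofExterior := id
  ofTangle := seg
  toGlue a := Quot.mk _ (.inl a)
  compat i := by rw [h]; rfl
  toGlue_ofExterior _ := rfl
  toGlue_ofTangle i := Quot.sound ⟨i, rfl, by rw [h]⟩
  cover a := .inl ⟨a, rfl⟩

/-- The model if all but one region of the tangle meet the boundary in exactly one segment. -/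
def RegionModel.addRegion (E : PreDiagram) {k s c p : ℕ} (seg : Fin s → E.Region)
    (T : Tangle k s c p (s + 1)) (h : ∀ i, T.boundary i = i.castSucc) :
    RegionModel E seg T (Fin 1 ⊕ E.Region) where
  ofExterior := Sum.inr
  ofTangle := Fin.snoc (α := fun _ => Fin 1 ⊕ E.Region) (fun i => Sum.inr (seg i)) (Sum.inl 0)
  toGlue := Sum.elim (fun _ => Quot.mk _ (.inr (Fin.last s))) fun a => Quot.mk _ (.inl a)
  compat i := by rw [h, Fin.snoc_castSucc]
  toGlue_ofExterior _ := rfl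
  toGlue_ofTangle i := by
    induction i using Fin.lastCases with
    | last => rw [Fin.snoc_last]; rfl
    | cast i =>
      rw [Fin.snoc_castSucc]
      exact Quot.sound ⟨i, rfl, by rw [h]⟩
  cover y := by
    rcases y with i | a
    · refine .inr ⟨Fin.last s, ?_⟩
      rw [Fin.snoc_last, Subsingleton.elim i 0]
    · exact .inl ⟨a, rfl⟩

/-- The model for the union with two strands, given by a quotient `X` of the set of regions of the
exterior and a section `j`. -/
def RegionModel.ofTwoStrands (E : PreDiagram) (seg : Fin 4 → E.Region) {X : Type}
    (a : E.Region → X) (j : X → E.Region) (haj : ∀ y, a (j y) = y) (h : a (seg 3) = a (seg 1))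
    (hja : ∀ r, j (a r) = r ∨ (r = seg 3 ∧ j (a r) = seg 1)) :
    RegionModel E seg twoStrands X where
  ofExterior := a
  ofTangle := ![a (seg 0), a (seg 1), a (seg 2)]
  toGlue y := Quot.mk _ (.inl (j y))
  compat i := by
    fin_cases i
    exacts [rfl, rfl, rfl, h]
  toGlue_ofExterior r := by
    rcases hja r with h1 | ⟨rfl, h1⟩
    · rw [h1]
    · rw [h1]
      -- The segments `1` and `3` both bound the middle region of the tangle, which identifies their
      -- exterior regions.
      exact (Quot.sound ⟨1, rfl, rfl⟩).trans (Quot.sound ⟨3, rfl, rfl⟩).symm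
  toGlue_ofTangle i := by
    have key : ∀ r, (Quot.mk _ (.inl (j (a r))) : E.GlueRegion seg twoStrands)
        = Quot.mk _ (.inl r) := by
      intro r
      rcases hja r with h1 | ⟨rfl, h1⟩
      · rw [h1]
      · rw [h1]
        exact (Quot.sound ⟨1, rfl, rfl⟩).trans (Quot.sound ⟨3, rfl, rfl⟩).symm
    fin_cases i
    · exact (key (seg 0)).trans (Quot.sound ⟨0, rfl, rfl⟩)
    · exact (key (seg 1)).trans (Quot.sound ⟨1, rfl, rfl⟩)
    · exact (key (seg 2)).trans (Quot.sound ⟨2, rfl, rfl⟩)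
  cover y := .inl ⟨j y, haj y⟩

end Models

/-! ### Invariance under the individual moves -/

section Moves

variable {S : Type*} [CommRing S]

open Tangle

/-- Unions with the same exterior are compared by means of models. -/
theorem SREquiv.of_models {D D' E : PreDiagram} {k s c p r c' p' r' : ℕ}
    {arc : Fin k ↪ Passage E.Crossing E.Point} {seg : Fin s → E.Region} {T : Tangle k s c p r}
    {T' : Tangle k s c' p' r'}
    (f : PreDiagram.Iso D (E.glue arc seg T)) (f' : PreDiagram.Iso D' (E.glue arc seg T'))
    {X X' : Type} [Finite X] [Finite X'] (M : RegionModel E seg T X) (M' : RegionModel E seg T' X')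
    (φ : BaseRing →+* S)
    (h : ∀ {l l' : ℕ} (e : X ≃ Fin l) (e' : X' ≃ Fin l'),
      SREquiv (SRPair.ofForm (-(E.crossingNumbers + T.crossingNumbers))
        (glueForm (E.form φ) T (variableImage φ) M.ofExterior M.ofTangle)
        (glueForm_symm (E.form_symm φ) _ _ _ _) e)
      (SRPair.ofForm (-(E.crossingNumbers + T'.crossingNumbers))
        (glueForm (E.form φ) T' (variableImage φ) M'.ofExterior M'.ofTangle)
        (glueForm_symm (E.form_symm φ) _ _ _ _) e'))
    {n n' : ℕ} (e : D.Region ≃ Fin n) (e' : D'.Region ≃ Fin n') :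
    SREquiv (D.srPair φ e) (D'.srPair φ e') :=
  ((SREquiv.of_regionModel f M φ e (Finite.equivFin X)).trans (h _ _)).trans
    (SREquiv.of_regionModel f' M' φ e' (Finite.equivFin X')).symm

/-- The evaluation at a point as a linear functional. -/
def evalAt {ι : Type*} (i : ι) : (ι → S) →ₗ[S] S := LinearMap.proj i

theorem evalAt_apply {ι : Type*} (i : ι) (u : ι → S) : evalAt i u = u i := rfl

/-- The addition of a linear functional to the first coordinate. -/
def shear {R : Type*} (l : (R → S) →ₗ[S] S) : (Fin 1 ⊕ R → S) →ₗ[S] (Fin 1 ⊕ R → S) :=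
  LinearMap.pi (Sum.elim (fun _ => LinearMap.proj (Sum.inl 0) + l ∘ₗ funLeft S S Sum.inr)
    fun a => LinearMap.proj (Sum.inr a))

theorem shear_inl {R : Type*} (l : (R → S) →ₗ[S] S) (u : Fin 1 ⊕ R → S) (i : Fin 1) :
    shear l u (.inl i) = u (.inl 0) + l (u ∘ Sum.inr) := rfl

theorem shear_comp_inr {R : Type*} (l : (R → S) →ₗ[S] S) (u : Fin 1 ⊕ R → S) :
    shear l u ∘ Sum.inr = u ∘ Sum.inr := rfl

theorem shear_shear_neg {R : Type*} (l : (R → S) →ₗ[S] S) (u : Fin 1 ⊕ R → S) :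
    shear l (shear (-l) u) = u := by
  ext (i | a)
  · rw [Subsingleton.elim i 0, shear_inl, shear_comp_inr, shear_inl]
    simp
  · rfl

/-- A tangle with one crossing that encloses one region splits off a summand of rank one. -/
theorem SREquiv.of_kink {D D' E : PreDiagram}
    {arc : Fin 1 ↪ Passage E.Crossing E.Point} {seg : Fin 2 → E.Region} {T : Tangle 1 2 1 0 3}
    (f : PreDiagram.Iso D (E.glue arc seg strand)) (f' : PreDiagram.Iso D' (E.glue arc seg T))
    (φ : BaseRing →+* S) (hT : ∀ i, T.boundary i = i.castSucc) (ε : ℤˣ) (hε : T.sign 0 = ε)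
    (a b : S) (hform : ∀ u v, T.form (variableImage φ) u v
      = ((ε : ℤ) : S) * (u 2 + (a * u 0 + b * u 1)) * (v 2 + (a * v 0 + b * v 1)))
    {n n' : ℕ} (e : D.Region ≃ Fin n) (e' : D'.Region ≃ Fin n') :
    SREquiv (D.srPair φ e) (D'.srPair φ e') := by
  refine SREquiv.of_models f f' (RegionModel.ofStrand E seg strand (by decide))
    (RegionModel.addRegion E seg T hT) φ (fun e e' => SREquiv.symm ?_) e e'
  have hsign : T.crossingNumbers = srShift (unitSign ε) := by
    rw [srShift_unitSign, ← hε]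
    simp [Tangle.crossingNumbers]
  -- The new coordinate at the enclosed region is the linear form whose square is the form of the
  -- kink; `F` does not involve it.
  refine SREquiv.split_one (Equiv.refl _) (unitSign ε) ?_
    (shear (a • LinearMap.proj (seg 0) + b • LinearMap.proj (seg 1)))
    (shear (-(a • LinearMap.proj (seg 0) + b • LinearMap.proj (seg 1))))
    (shear_shear_neg _) ?_ e' e
  · rw [hsign, show strand.crossingNumbers = 0 by simp [Tangle.crossingNumbers]]
    abel
  · intro u v
    rw [glueForm_apply, glueForm_apply, strand_form, hform, coe_unitSign, shear_comp_inr,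
      shear_comp_inr, shear_inl, shear_inl]
    change E.form φ (u ∘ Sum.inr) (v ∘ Sum.inr) + ((ε : ℤ) : S)
        * (u (.inl 0) + (a * u (.inr (seg 0)) + b * u (.inr (seg 1))))
        * (v (.inl 0) + (a * v (.inr (seg 0)) + b * v (.inr (seg 1))))
      = (u (.inl 0) + (a * u (.inr (seg 0)) + b * u (.inr (seg 1)))) * ((ε : ℤ) : S)
        * (v (.inl 0) + (a * v (.inr (seg 0)) + b * v (.inr (seg 1))))
        + (E.form φ (u ∘ Sum.inr) (v ∘ Sum.inr) + 0)
    ring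

/-- Triangles whose forms differ by a shear are exchangeable. -/
theorem SREquiv.of_triangle {D D' E : PreDiagram}
    {arc : Fin 3 ↪ Passage E.Crossing E.Point} {seg : Fin 6 → E.Region} {T T' : Tangle 3 6 3 0 7}
    (f : PreDiagram.Iso D (E.glue arc seg T)) (f' : PreDiagram.Iso D' (E.glue arc seg T'))
    (φ : BaseRing →+* S) (hT : ∀ i, T.boundary i = i.castSucc)
    (hT' : ∀ i, T'.boundary i = i.castSucc) (hsign : T.sign = T'.sign)
    (h : ∃ c : Fin 6 → S, ∀ u v, T'.form (variableImage φ) u v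
      = T.form (variableImage φ) (triangleShear c u) (triangleShear c v))
    {n n' : ℕ} (e : D.Region ≃ Fin n) (e' : D'.Region ≃ Fin n') :
    SREquiv (D.srPair φ e) (D'.srPair φ e') := by
  obtain ⟨c, hc⟩ := h
  refine SREquiv.of_models f f' (RegionModel.addRegion E seg T hT)
    (RegionModel.addRegion E seg T' hT') φ (fun e e' => SREquiv.symm ?_) e e'
  -- The functional of `triangleShear` pulled back along `seg`; coefficients add up where segments
  -- lie in a common region.
  set l : (E.Region → S) →ₗ[S] S := c 0 • LinearMap.proj (seg 0) + c 1 • LinearMap.proj (seg 1)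
    + c 2 • LinearMap.proj (seg 2) + c 3 • LinearMap.proj (seg 3) + c 4 • LinearMap.proj (seg 4)
    + c 5 • LinearMap.proj (seg 5)
  refine SREquiv.of_linear (Equiv.refl _) ?_ (shear l) (shear (-l)) (shear_shear_neg _) ?_ e' e
  · rw [Tangle.crossingNumbers, Tangle.crossingNumbers, hsign]
  · intro u v
    have hs : ∀ w : Fin 1 ⊕ E.Region → S,
        shear l w ∘ (RegionModel.addRegion E seg T hT).ofTangle
          = triangleShear c (w ∘ (RegionModel.addRegion E seg T' hT').ofTangle) := by
      intro w
      ext i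
      fin_cases i <;> rfl
    rw [glueForm_apply, glueForm_apply, hc, hs, hs]
    rfl

/-- Two crossings of opposite signs that enclose a bigon cancel. -/
theorem SREquiv.of_bigon {D D' E : PreDiagram}
    {arc : Fin 2 ↪ Passage E.Crossing E.Point} {seg : Fin 4 → E.Region} {T : Tangle 2 4 2 0 5}
    (f : PreDiagram.Iso D (E.glue arc seg twoStrands)) (f' : PreDiagram.Iso D' (E.glue arc seg T))
    (φ : BaseRing →+* S) (hT : ∀ i, T.boundary i = i.castSucc) (ε : ℤˣ)
    (hε : T.sign = ![ε, -ε]) (q : S)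
    (hform : ∀ u v, T.form (variableImage φ) u v = bigonForm ε (variableImage φ) q u v)
    {n n' : ℕ} (e : D.Region ≃ Fin n) (e' : D'.Region ≃ Fin n') :
    SREquiv (D.srPair φ e) (D'.srPair φ e') := by
  classical
  have hsign : T.crossingNumbers = 1 := by
    rw [← signVector_add_neg ε, Tangle.crossingNumbers, hε, Fin.sum_univ_two]
    rfl
  have htwo : twoStrands.crossingNumbers = 0 := by simp [Tangle.crossingNumbers]
  have hone : srShift 0 = 1 := by decide
  -- If the top and bottom regions already agree outside the disc, `bigonForm` vanishes and the
  -- value at the bigon enters no term: it splits off `[0]`, with shift `(1, 1)`.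
  by_cases h13 : seg 3 = seg 1
  · refine SREquiv.of_models f f' (RegionModel.ofTwoStrands E seg id id (fun _ => rfl) h13
      fun _ => .inl rfl) (RegionModel.addRegion E seg T hT) φ (fun e e' => SREquiv.symm ?_) e e'
    refine SREquiv.split_one (Equiv.refl _) 0 ?_ LinearMap.id LinearMap.id (fun _ => rfl) ?_ e' e
    · rw [hsign, htwo, hone]
      abel
    · intro u v
      rw [glueForm_apply, glueForm_apply, twoStrands_form, hform]
      have h : ∀ w : Fin 1 ⊕ E.Region → S,
          (w ∘ (RegionModel.addRegion E seg T hT).ofTangle) 3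
            = (w ∘ (RegionModel.addRegion E seg T hT).ofTangle) 1 :=
        fun w => congrArg (fun r => w (.inr r)) h13
      rw [bigonForm, h, h]
      simp
      rfl
  -- Otherwise removing the two crossings merges `seg 3` into `seg 1`: `Y` models the merged regions
  -- and `a` is the projection.
  · set Y := {r : E.Region // r ≠ seg 3}
    set a : E.Region → Y := fun r => if hr : r = seg 3 then ⟨seg 1, Ne.symm h13⟩ else ⟨r, hr⟩
      with ha
    have haj : ∀ y : Y, a y = y := fun y => by simp [ha, y.2]
    have ha3 : a (seg 3) = ⟨seg 1, Ne.symm h13⟩ := by simp [ha]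
    have hane : ∀ r, r ≠ seg 3 → ((a r : Y) : E.Region) = r := fun r hr => by simp [ha, hr]
    refine SREquiv.of_models f f' (RegionModel.ofTwoStrands E seg a Subtype.val haj ?_ ?_)
      (RegionModel.addRegion E seg T hT) φ (fun e e' => SREquiv.symm ?_) e e'
    · rw [ha3]
      exact (haj ⟨seg 1, Ne.symm h13⟩).symm
    · intro r
      by_cases hr : r = seg 3
      · exact .inr ⟨hr, by rw [hr, ha3]⟩
      · exact .inl (hane r hr)
    set F := E.form φ with hF
    set x := variableImage φ with hx
    set d : E.Region → S := Pi.single (seg 3) 1 with hd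
    have hε2 : ((ε : ℤ) : S) * ((ε : ℤ) : S) = 1 := by
      rcases Int.units_eq_one_or ε with h | h <;> simp [h]
    have hσ : Nonempty (Fin 1 ⊕ E.Region ≃ Fin 2 ⊕ Y) := by
      have hR : Nat.card E.Region = Nat.card Y + 1 := by
        rw [← Finite.card_option]
        exact Nat.card_congr (Equiv.optionSubtypeNe (seg 3)).symm
      exact Finite.card_eq.1 (by simp [Nat.card_sum, hR]; omega)
    -- An exterior function `w` is `w̄ + P₁ w • d`, where `w̄` comes from `Y`. Expanding `F`
    -- accordingly, the terms linear in `P₁` are `F d w̄`; added to the partner of `u 3 - u 1` in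
    -- `bigonForm`, they form the second hyperbolic coordinate `P₀`.
    set P₁ : (Fin 1 ⊕ E.Region → S) →ₗ[S] S :=
      evalAt (Sum.inr (seg 3)) - evalAt (Sum.inr (seg 1)) with hP₁
    set P₀ : (Fin 1 ⊕ E.Region → S) →ₗ[S] S :=
      F d ∘ₗ funLeft S S (fun r => Sum.inr (a r : E.Region)) - ((ε : ℤ) : S) •
        (evalAt (Sum.inl 0)
          + x • (evalAt (Sum.inr (seg 0)) + evalAt (Sum.inr (seg 2)))
          + q • evalAt (Sum.inr (seg 1))) with hP₀
    set p : (Fin 1 ⊕ E.Region → S) →ₗ[S] (Fin 2 ⊕ Y → S) :=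
      LinearMap.pi (Sum.elim ![P₀, P₁] fun y => evalAt (Sum.inr (y : E.Region))) with hp
    -- The inverse: `G` restores the value at `seg 3` from that at `seg 1` and `P₁`, and `G₀` solves
    -- `P₀` for the value at the bigon, whose coefficient `-ε` is invertible.
    set G : E.Region → (Fin 2 ⊕ Y → S) →ₗ[S] S := fun r =>
      evalAt (Sum.inr (a r)) + d r • evalAt (Sum.inl 1) with hG
    set G₀ : (Fin 2 ⊕ Y → S) →ₗ[S] S :=
      ((ε : ℤ) : S) • (F d ∘ₗ funLeft S S (fun r => Sum.inr (a r)) - evalAt (Sum.inl 0))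
        - x • (G (seg 0) + G (seg 2)) - q • G (seg 1) with hG₀
    set g : (Fin 2 ⊕ Y → S) →ₗ[S] (Fin 1 ⊕ E.Region → S) :=
      LinearMap.pi (Sum.elim (fun _ => G₀) G) with hg
    have hd3 : d (seg 3) = 1 := by simp [hd]
    have hdne : ∀ r, r ≠ seg 3 → d r = 0 := fun r hr => by simp [hd, hr]
    have ha1 : a (seg 1) = ⟨seg 1, Ne.symm h13⟩ := haj ⟨seg 1, Ne.symm h13⟩
    have hGy : ∀ (y : Y) w, G y w = w (.inr y) := by
      intro y w
      simp [hG, haj, hdne _ y.2, evalAt_apply]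
    -- The parameter collects the terms in `P₁ u * P₁ v`: `F d d` from the exterior and `-ε q` from
    -- the tangle.
    refine SREquiv.split_hyperbolic hσ.some (F d d - ((ε : ℤ) : S) * q) ?_ p g ?_ ?_ e' e
    · rw [hsign, htwo]
      abel
    · intro w
      have h1 : g w (.inr (seg 3)) - g w (.inr (seg 1)) = w (.inl 1) := by
        change G (seg 3) w - G (seg 1) w = _
        simp [hG, evalAt_apply, ha3, ha1, hd3, hdne _ (Ne.symm h13)]
      have h2 : (fun r => g w (.inr (a r : E.Region))) = fun r => w (.inr (a r)) := by
        ext r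
        exact hGy _ _
      ext (i | y)
      · fin_cases i
        · change F d (fun r => g w (.inr (a r : E.Region))) - ((ε : ℤ) : S) *
            (((ε : ℤ) : S) * (F d (fun r => w (.inr (a r))) - w (.inl 0))
              - x * (G (seg 0) w + G (seg 2) w) - q * G (seg 1) w
              + x * (G (seg 0) w + G (seg 2) w) + q * G (seg 1) w) = w (.inl 0)
          rw [h2]
          linear_combination (w (.inl 0) - F d (fun r => w (.inr (a r)))) * hε2
        · exact h1
      · exact hGy y w
    · intro u v
      have hsplit : ∀ w : Fin 1 ⊕ E.Region → S,
          w ∘ Sum.inr = (fun r => w (.inr (a r : E.Region))) + P₁ w • d := by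
        intro w
        ext r
        by_cases hr : r = seg 3
        · simp [hr, ha3, hd3, hP₁, evalAt_apply]
        · simp [hane r hr, hdne r hr]
      rw [glueForm_apply, glueForm_apply, twoStrands_form, hform]
      change F (u ∘ Sum.inr) (v ∘ Sum.inr) + -((ε : ℤ) : S) *
          (P₁ u * (v (.inl 0) + x * (v (.inr (seg 0)) + v (.inr (seg 2))) + q * v (.inr (seg 1)))
          + (u (.inl 0) + x * (u (.inr (seg 0)) + u (.inr (seg 2))) + q * u (.inr (seg 1))) * P₁ v
          + q * P₁ u * P₁ v)
        = (F d (fun r => u (.inr (a r : E.Region))) - ((ε : ℤ) : S) *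
            (u (.inl 0) + x * (u (.inr (seg 0)) + u (.inr (seg 2))) + q * u (.inr (seg 1)))) * P₁ v
          + P₁ u * (F d (fun r => v (.inr (a r : E.Region))) - ((ε : ℤ) : S) *
            (v (.inl 0) + x * (v (.inr (seg 0)) + v (.inr (seg 2))) + q * v (.inr (seg 1))))
          + (F d d - ((ε : ℤ) : S) * q) * P₁ u * P₁ v
          + (F (fun r => u (.inr (a r : E.Region))) (fun r => v (.inr (a r : E.Region))) + 0)
      rw [hsplit u, hsplit v]
      simp only [map_add, map_smul, LinearMap.add_apply, LinearMap.smul_apply, smul_eq_mul]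
      rw [E.form_symm φ (fun r => u (.inr (a r : E.Region))) d]
      ring

/-- Diagrams that differ by a replacement of tangles have SR-equivalent pairs. -/
theorem SREquiv.of_replace {D D' E : PreDiagram} {k s c p r c' p' r' : ℕ} {T : Tangle k s c p r}
    {T' : Tangle k s c' p' r'} (hT : Tangle.Replace T T')
    {arc : Fin k ↪ Passage E.Crossing E.Point} {seg : Fin s → E.Region}
    (f : PreDiagram.Iso D (E.glue arc seg T)) (f' : PreDiagram.Iso D' (E.glue arc seg T'))
    (φ : BaseRing →+* S) {n n' : ℕ} (e : D.Region ≃ Fin n) (e' : D'.Region ≃ Fin n') :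
    SREquiv (D.srPair φ e) (D'.srPair φ e') := by
  cases hT with
  | mark =>
    refine SREquiv.of_models f f' (RegionModel.ofStrand E seg _ (by decide))
      (RegionModel.ofStrand E seg _ (by decide)) φ (fun e e' => ?_) e e'
    refine SREquiv.of_equiv (Equiv.refl _) (by simp [Tangle.crossingNumbers]) ?_ e e'
    intro u v
    rw [glueForm_apply, glueForm_apply, strand_form, markedStrand_form]
    rfl
  | kinkRight ε =>
    exact SREquiv.of_kink f f' φ (fun i => by fin_cases i <;> rfl) ε rfl _ _
      (kinkRight_form ε _) e e'
  | kinkLeft ε =>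
    exact SREquiv.of_kink f f' φ (fun i => by fin_cases i <;> rfl) ε rfl _ _
      (kinkLeft_form ε _) e e'
  | bigonParallel ε =>
    exact SREquiv.of_bigon f f' φ (fun i => by fin_cases i <;> rfl) ε rfl _
      (bigonParallel_form ε _) e e'
  | bigonUpDown ε =>
    exact SREquiv.of_bigon f f' φ (fun i => by fin_cases i <;> rfl) ε rfl _
      (bigonUpDown_form ε _) e e'
  | bigonDownUp ε =>
    exact SREquiv.of_bigon f f' φ (fun i => by fin_cases i <;> rfl) ε rfl _
      (bigonDownUp_form ε _) e e'
  | braid ε h =>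
    exact SREquiv.of_triangle f f' φ (fun i => by fin_cases i <;> rfl)
      (fun i => by fin_cases i <;> rfl) rfl
      (exists_triangleShear_braid ε h (isUnit_two_mul_variableImage_add_one φ)) e e'
  | cyclic ε h =>
    exact SREquiv.of_triangle f f' φ (fun i => by fin_cases i <;> rfl)
      (fun i => by fin_cases i <;> rfl) rfl (exists_triangleShear_cyclic ε h _) e e'

/-- Reidemeister equivalent diagrams have SR-equivalent pairs. -/
theorem SREquiv.of_reidemeisterEquiv (φ : BaseRing →+* S) {D D' : LinkDiagram}
    (h : ReidemeisterEquiv D D') {n n' : ℕ} (e : D.Region ≃ Fin n) (e' : D'.Region ≃ Fin n') :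
    SREquiv (D.toPreDiagram.srPair φ e) (D'.toPreDiagram.srPair φ e') := by
  induction h generalizing n n' with
  | rel D D' h =>
    cases h with
    | iso f => exact SREquiv.of_iso f φ e e'
    | replace T T' hT E arc seg f f' => exact SREquiv.of_replace hT f f' φ e e'
  -- The two enumerations may differ even here.
  | refl D =>
    rw [PreDiagram.srPair_eq, PreDiagram.srPair_eq]
    exact SREquiv.of_equiv (Equiv.refl _) rfl (fun _ _ => rfl) e e'
  | symm D D' _ ih => exact (ih e' e).symm
  | trans D D' D'' _ _ ih ih' =>
    exact (ih e (Finite.equivFin D'.Region)).trans (ih' (Finite.equivFin D'.Region) e')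

end Moves

end LinkAmplitude

theorem theorem1 {S : Type*} [CommRing S] (φ : LinkAmplitude.BaseRing →+* S)
    (D D' : LinkAmplitude.LinkDiagram) (h : LinkAmplitude.ReidemeisterEquiv D D') {n n' : ℕ}
    (e : D.Region ≃ Fin n) (e' : D'.Region ≃ Fin n') :
    LinkAmplitude.SREquiv (D.toPreDiagram.srPair φ e) (D'.toPreDiagram.srPair φ e') :=
  LinkAmplitude.SREquiv.of_reidemeisterEquiv φ h e e'
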